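/- Let $k$ be a field, let $Y$ be an arbitrary set, and let $K=k[Y]$ be the free commutative (associative, unital) $k$-algebra on $Y$, that is, the polynomial algebra. A non-associative $K$-algebra is a $K$-module with a $K$-bilinear multiplication; the multiplication need not be associative and no unit is required. Let $A$ be a non-associative $K$-algebra that is generated, as a $K$-algebra, by a countable (possibly finite) subset. Then there exist a non-associative $K$-algebra $B$ (over the same $K$), generated as a $K$-algebra by two elements, and an injective homomorphism of $K$-algebras $A\to B$. -/

import Mathlib

universe u v w

/-!
No identity constrains a non-associative multiplication: any bilinear map on a module is one.
Hence a countably generated algebra `A` over a commutative ring `R`, with generators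
`x 0, x 1, …`, embeds in a two-generated one built directly on the module `A ⊕ R^(ℕ)`.
Let `e 0, e 1, …` be the standard basis of the free summand. Keep the multiplication of `A`, put
`e 0 * e n = e (n + 1)` and `e 1 * e n = x n`, and let all other products of basis vectors with
each other or with elements of `A` vanish. Then `A` is a subalgebra. Left multiplication by `e 0`
produces every `e n` from `e 1`, left multiplication by `e 1` turns these into the generators of
`A`, and so `e 0` and `e 1` generate everything (`SequenceExtension.adjoin_pair_eq_top`).
As `R^(ℕ)` is a direct summand, torsion in the module `A` plays no role.
-/

/-- The module `A ⊕ R^(ℕ)`, to be multiplied in a way that depends on the sequence `x` in `A`.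
It is a type synonym, so as not to inherit the componentwise multiplication of the product. -/
def SequenceExtension (R : Type*) {A : Type*} [CommRing R] [NonUnitalNonAssocRing A]
    (_x : ℕ → A) : Type _ :=
  A × (ℕ →₀ R)

namespace SequenceExtension

variable {R A : Type*} [CommRing R] [NonUnitalNonAssocRing A] (x : ℕ → A)

noncomputable instance : AddCommGroup (SequenceExtension R x) :=
  inferInstanceAs (AddCommGroup (A × (ℕ →₀ R)))

variable {x}

@[ext]
theorem ext {p q : SequenceExtension R x} (h₁ : p.1 = q.1) (h₂ : p.2 = q.2) : p = q :=
  Prod.ext h₁ h₂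

/-- The element of the extension with the given components. -/
def mk (a : A) (f : ℕ →₀ R) : SequenceExtension R x := (a, f)

@[simp] theorem fst_mk (a : A) (f : ℕ →₀ R) : (mk a f : SequenceExtension R x).1 = a := rfl

@[simp] theorem snd_mk (a : A) (f : ℕ →₀ R) : (mk a f : SequenceExtension R x).2 = f := rfl

@[simp] theorem fst_zero : (0 : SequenceExtension R x).1 = 0 := rfl

@[simp] theorem snd_zero : (0 : SequenceExtension R x).2 = 0 := rfl

@[simp] theorem fst_add (p q : SequenceExtension R x) : (p + q).1 = p.1 + q.1 := rfl

@[simp] theorem snd_add (p q : SequenceExtension R x) : (p + q).2 = p.2 + q.2 := rfl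

variable [Module R A]

noncomputable instance : Module R (SequenceExtension R x) :=
  inferInstanceAs (Module R (A × (ℕ →₀ R)))

/-- The bilinear extension of `e 0 * e n = e (n + 1)`, `e 1 * e n = x n` and of the multiplication
of `A`, all other products being zero. -/
noncomputable instance : Mul (SequenceExtension R x) where
  mul p q := (p.1 * q.1 + p.2 1 • Finsupp.linearCombination R x q.2,
    p.2 0 • Finsupp.lmapDomain R R Nat.succ q.2)

@[simp] theorem fst_smul (r : R) (p : SequenceExtension R x) : (r • p).1 = r • p.1 := rfl

@[simp] theorem snd_smul (r : R) (p : SequenceExtension R x) : (r • p).2 = r • p.2 := rfl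

@[simp] theorem fst_mul (p q : SequenceExtension R x) :
    (p * q).1 = p.1 * q.1 + p.2 1 • Finsupp.linearCombination R x q.2 := rfl

@[simp] theorem snd_mul (p q : SequenceExtension R x) :
    (p * q).2 = p.2 0 • Finsupp.lmapDomain R R Nat.succ q.2 := rfl

noncomputable instance : NonUnitalNonAssocRing (SequenceExtension R x) where
  left_distrib p q r := by
    ext1
    · simp only [fst_mul, fst_add, snd_add, map_add, smul_add, mul_add]
      abel
    · simp only [snd_mul, snd_add, map_add, smul_add]
  right_distrib p q r := by
    ext1
    · simp only [fst_mul, fst_add, snd_add, Finsupp.add_apply, add_smul, add_mul]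
      abel
    · simp only [snd_mul, snd_add, Finsupp.add_apply, add_smul]
  zero_mul p := by ext1 <;> simp
  mul_zero p := by ext1 <;> simp

instance [IsScalarTower R A A] :
    IsScalarTower R (SequenceExtension R x) (SequenceExtension R x) where
  smul_assoc r p q := by
    ext1 <;> simp [smul_smul, smul_mul_assoc]

instance [SMulCommClass R A A] :
    SMulCommClass R (SequenceExtension R x) (SequenceExtension R x) where
  smul_comm r p q := by
    ext1
    · simp only [smul_eq_mul, fst_smul, fst_mul, snd_smul, map_smul, smul_add, mul_smul_comm,
        smul_comm r (p.2 1)]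
    · simp only [smul_eq_mul, snd_smul, snd_mul, map_smul, smul_comm r (p.2 0)]

variable (R x)

/-- The inclusion of `A` as the first summand. -/
noncomputable def inclusion : A →ₙₐ[R] SequenceExtension R x where
  toFun a := mk a 0
  map_smul' r a := by ext1 <;> simp
  map_zero' := rfl
  map_add' a b := by ext1 <;> simp
  map_mul' a b := by ext1 <;> simp

/-- The standard basis vector `e n` of the free summand. -/
noncomputable def basisVector (n : ℕ) : SequenceExtension R x :=
  mk 0 (Finsupp.single n 1)

@[simp] theorem fst_inclusion (a : A) : (inclusion R x a).1 = a := rfl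

@[simp] theorem snd_inclusion (a : A) : (inclusion R x a).2 = 0 := rfl

theorem inclusion_injective : Function.Injective (inclusion R x) :=
  fun _ _ h => congrArg Prod.fst h

theorem basisVector_zero_mul (n : ℕ) :
    basisVector R x 0 * basisVector R x n = basisVector R x (n + 1) := by
  ext1 <;> simp [basisVector]

theorem basisVector_one_mul (n : ℕ) :
    basisVector R x 1 * basisVector R x n = inclusion R x (x n) := by
  ext1 <;> simp [basisVector]

theorem adjoin_pair_eq_top [IsScalarTower R A A] [SMulCommClass R A A]
    (hx : NonUnitalAlgebra.adjoin R (Set.range x) = ⊤) :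
    NonUnitalAlgebra.adjoin R {basisVector R x 0, basisVector R x 1} = ⊤ := by
  set S := NonUnitalAlgebra.adjoin R {basisVector R x 0, basisVector R x 1}
  have h0 : basisVector R x 0 ∈ S := NonUnitalAlgebra.subset_adjoin R (by simp)
  have h1 : basisVector R x 1 ∈ S := NonUnitalAlgebra.subset_adjoin R (by simp)
  have hbasis (n : ℕ) : basisVector R x n ∈ S := by
    induction n with
    | zero => exact h0
    | succ n ih => exact basisVector_zero_mul R x n ▸ mul_mem h0 ih
  have hincl (a : A) : inclusion R x a ∈ S := by
    have hle : NonUnitalAlgebra.adjoin R (Set.range x) ≤ S.comap (inclusion R x) := by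
      rw [NonUnitalAlgebra.adjoin_le_iff]
      rintro _ ⟨n, rfl⟩
      rw [SetLike.mem_coe, NonUnitalSubalgebra.mem_comap, ← basisVector_one_mul]
      exact mul_mem h1 (hbasis n)
    exact hle (hx ▸ NonUnitalAlgebra.mem_top)
  have hfree (f : ℕ →₀ R) : (mk 0 f : SequenceExtension R x) ∈ S := by
    induction f using Finsupp.induction_linear with
    | zero => exact zero_mem S
    | add f g hf hg =>
      convert add_mem hf hg using 1
      ext1 <;> simp
    | single n r =>
      convert SMulMemClass.smul_mem r (hbasis n) using 1
      ext1 <;> simp [basisVector]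
  refine eq_top_iff.2 fun p _ => ?_
  convert add_mem (hincl p.1) (hfree p.2) using 1
  ext1 <;> simp

end SequenceExtension

theorem corollary3p2 (k : Type u) [Field k] (Y : Type v)
    (A : Type w) [NonUnitalNonAssocRing A] [Module (MvPolynomial Y k) A]
    [IsScalarTower (MvPolynomial Y k) A A] [SMulCommClass (MvPolynomial Y k) A A]
    (hA : ∃ X : Set A, X.Countable ∧ NonUnitalAlgebra.adjoin (MvPolynomial Y k) X = ⊤) :
    ∃ (B : Type (max u v w)) (_ : NonUnitalNonAssocRing B) (_ : Module (MvPolynomial Y k) B)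
      (_ : IsScalarTower (MvPolynomial Y k) B B) (_ : SMulCommClass (MvPolynomial Y k) B B),
      (∃ a b : B, NonUnitalAlgebra.adjoin (MvPolynomial Y k) {a, b} = ⊤) ∧
      ∃ φ : A →ₙₐ[MvPolynomial Y k] B, Function.Injective φ := by
  obtain ⟨X, hX, htop⟩ := hA
  -- Adding `0` makes the generating set nonempty, hence the range of a sequence.
  obtain ⟨x, hx⟩ := (hX.insert 0).exists_eq_range (Set.insert_nonempty 0 X)
  have hgen : NonUnitalAlgebra.adjoin (MvPolynomial Y k) (Set.range x) = ⊤ := by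
    rw [eq_top_iff, ← htop, ← hx]
    exact NonUnitalAlgebra.adjoin_mono (Set.subset_insert 0 X)
  exact ⟨SequenceExtension (MvPolynomial Y k) x, inferInstance, inferInstance, inferInstance,
    inferInstance, ⟨_, _, SequenceExtension.adjoin_pair_eq_top _ x hgen⟩,
    SequenceExtension.inclusion _ x, SequenceExtension.inclusion_injective _ x⟩
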